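/- Let $\alpha>0$ and let $X=(X_t)_{t\ge 0}$ be a stochastic process on a probability space $(\Omega,\mathcal F,P)$ with values in a finite-dimensional Euclidean space $E$ (for instance $E=\mathbb R$ or $\mathbb{R}^d$). Suppose that 1. $X$ is $\alpha$-IDT, that is, for every integer $n\ge 1$ the processes $(X_{n^{1/\alpha}t})_{t\ge 0}$ and $(X^{(1)}_t+\cdots+X^{(n)}_t)_{t\ge 0}$ have the same finite-dimensional distributions, where $X^{(1)},\dots,X^{(n)}$ are independent copies of $X$; 2. $X$ is stochastically continuous, that is, $X_s\to X_t$ in probability as $s\to t$, for every $t\ge 0$; 3. $X$ has independent increments. Then $X$ is (up to modification) a Lévy process time-changed by the deterministic clock $h(t)=t^{\alpha}$: there is a Lévy process $L=(L_t)_{t\ge 0}$ on $(\Omega,\mathcal F,P)$ with values in $E$ such that, for every $t\ge 0$, $$X_t=L_{t^{\alpha}}\quad\text{almost surely.}$$ In particular $L_1=X_1$ almost surely, and $(X_t)_{t\ge0}$ and $(L_{t^\alpha})_{t\ge0}$ have the same finite-dimensional distributions. Here a Lévy process is a process with independent and stationary increments, $L_0=0$ almost surely, which is stochastically continuous and whose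 paths are almost surely right-continuous with left limits. -/

import Mathlib

open MeasureTheory ProbabilityTheory Filter Topology
open scoped NNReal

namespace AlphaIDT

variable {Ω E : Type*} [MeasurableSpace Ω] [NormedAddCommGroup E] [MeasurableSpace E]

/-- The process `X` is `α`-IDT: for every `n ≥ 1`, the processes `(X_{n^{1/α} t})_t` and
`(X⁽¹⁾_t + ⋯ + X⁽ⁿ⁾_t)_t` have the same law on the path space `E^{[0,∞)}` (product σ-algebra),
where `X⁽¹⁾, …, X⁽ⁿ⁾` are independent copies of `X`. The copies are realised as the coordinate
copies `X⁽ⁱ⁾_t(ω) = X_t(ω_i)` on the product probability space `(Ωⁿ, Pⁿ)`; the law of their sum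
does not depend on the realisation. -/
def IsAlphaIDT (α : ℝ) (X : ℝ≥0 → Ω → E) (P : Measure Ω) : Prop :=
  ∀ n : ℕ, 0 < n →
    IdentDistrib
      (fun (ω : Ω) (t : ℝ≥0) ↦ X ((n : ℝ≥0) ^ (1 / α) * t) ω)
      (fun (ω : Fin n → Ω) (t : ℝ≥0) ↦ ∑ i, X t (ω i))
      P (Measure.pi fun _ : Fin n ↦ P)

/-- Stochastic continuity: `X_s → X_t` in probability as `s → t`, for every `t ≥ 0`. -/
def IsStochasticallyContinuous (X : ℝ≥0 → Ω → E) (P : Measure Ω) : Prop :=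
  ∀ t : ℝ≥0, TendstoInMeasure P X (𝓝 t) (X t)

/-- A path is càdlàg: right-continuous on `[0,∞)` with left limits on `(0,∞)`. -/
def IsCadlagPath (x : ℝ≥0 → E) : Prop :=
  (∀ t, ContinuousWithinAt x (Set.Ici t) t) ∧
    ∀ t, 0 < t → ∃ l : E, Tendsto x (𝓝[<] t) (𝓝 l)

/-- A Lévy process: independent and stationary increments, started at `0`, stochastically
continuous, with almost surely càdlàg paths. -/
structure IsLevyProcess (L : ℝ≥0 → Ω → E) (P : Measure Ω) : Prop where
  measurable : ∀ t, Measurable (L t)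
  indepIncrements : HasIndepIncrements L P
  stationaryIncrements : ∀ s t : ℝ≥0,
    IdentDistrib (fun ω ↦ L (s + t) ω - L s ω) (fun ω ↦ L t ω - L 0 ω) P P
  start_zero : ∀ᵐ ω ∂P, L 0 ω = 0
  stochasticallyContinuous : IsStochasticallyContinuous L P
  cadlag : ∀ᵐ ω ∂P, IsCadlagPath fun t ↦ L t ω

end AlphaIDT

/-!
# Stochastically continuous `α`-IDT processes with independent increments

Run with the clock `t ↦ t ^ (1 / α)`, the process `X` becomes a stochastically continuous process
`Y` with independent increments, and the IDT property says that the law of `Y (n * t)` is the `n`-th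
convolution power of the law of `Y t`. It must be shown that `Y` has stationary increments and a
càdlàg modification; that modification is the Lévy process.

*Stationarity.* Let `φ_t` be the characteristic function of `Y t`, so that `φ_{nt} = φ_t ^ n`.
At `t = 0` this forces `φ_0 = 1`, hence `Y 0 = 0` almost surely. As `φ_t = φ_{t/n} ^ n` and
`φ_{t/n} → φ_0 = 1`, the function `φ_t` has no zeros (`charFun_ne_zero_of_eq_pow`). The relation
`φ_{s+t} = φ_s φ_t` holds when `s` and `t` are multiples of a common number, hence everywhere by
continuity in time (`charFun_add_of_eq_pow`). By independence, `φ_{s+t}` is also `φ_s` times the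
characteristic function of `Y (s + t) - Y s`, and dividing by `φ_s` gives stationarity
(`identDistrib_increments_of_eq_pow`).

*Regularity of paths.* `exists_cadlag_modification` holds for every stochastically continuous
process with independent increments. On an interval in which no increment exceeds `c` with
probability more than `1 / 4`, Ottaviani's inequality bounds by `1 / 2` the probability that the
process, sampled on a finite grid, oscillates by more than `4 c`. Restarting after each oscillation,
`p` successive oscillations have probability at most `2⁻ᵖ` (`measure_hasOscillations_le`). This
bound does not depend on the grid, so that almost surely, for every size, only finitely many
oscillations occur along the dyadic times near any given time. Hence all one-sided limits along the
dyadic times exist, and the right limits form a càdlàg path. Stochastic continuity identifies them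
with `Y` at each fixed time.
-/

namespace AlphaIDT

/-! ### Oscillations of a path -/

section Oscillations

variable {T E : Type*} [LinearOrder T] [PseudoMetricSpace E]

/-- `HasOscillations x c M p r`: the path `x` makes `p` successive oscillations of size more than
`c` along points of `M` up to time `r`, that is, there are `u₁ < v₁ ≤ u₂ < v₂ ≤ ⋯ ≤ u_p < v_p ≤ r`
in `M` with `c < dist (x uᵢ) (x vᵢ)` for all `i`. The recursion singles out the last pair. -/
def HasOscillations (x : T → E) (c : ℝ) (M : Set T) : ℕ → T → Prop
  | 0, _ => True
  | p + 1, r => ∃ u ∈ M, ∃ v ∈ M, u < v ∧ v ≤ r ∧ HasOscillations x c M p u ∧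
      c < dist (x u) (x v)

lemma HasOscillations.mono {x : T → E} {c : ℝ} {M N : Set T} (hMN : M ⊆ N) {p : ℕ} {r s : T}
    (hrs : r ≤ s) (h : HasOscillations x c M p r) : HasOscillations x c N p s := by
  induction p generalizing r s with
  | zero => trivial
  | succ p ih =>
    obtain ⟨u, hu, v, hv, huv, hvr, hp, hc⟩ := h
    exact ⟨u, hMN hu, v, hMN hv, huv, hvr.trans hrs, ih le_rfl hp, hc⟩

lemma HasOscillations.of_size_le {x : T → E} {c d : ℝ} {M : Set T} {p : ℕ} {r : T} (hdc : d ≤ c)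
    (h : HasOscillations x c M p r) : HasOscillations x d M p r := by
  induction p generalizing r with
  | zero => trivial
  | succ p ih =>
    obtain ⟨u, hu, v, hv, huv, hvr, hp, hc⟩ := h
    exact ⟨u, hu, v, hv, huv, hvr, ih hp, hdc.trans_lt hc⟩

lemma HasOscillations.exists_of_iUnion {x : T → E} {c : ℝ} {M : ℕ → Set T} (hM : Monotone M)
    {p : ℕ} {r : T} (h : HasOscillations x c (⋃ n, M n) p r) :
    ∃ n, HasOscillations x c (M n) p r := by
  induction p generalizing r with
  | zero => exact ⟨0, trivial⟩
  | succ p ih =>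
    obtain ⟨u, hu, v, hv, huv, hvr, hp, hc⟩ := h
    obtain ⟨i, hi⟩ := Set.mem_iUnion.1 hu
    obtain ⟨j, hj⟩ := Set.mem_iUnion.1 hv
    obtain ⟨k, hk⟩ := ih hp
    refine ⟨max k (max i j), u, hM (by simp) hi, v, hM (by simp) hj, huv, hvr,
      hk.mono (hM (by simp)) le_rfl, hc⟩

/-- Oscillations along the range of a monotone sequence are oscillations of the sampled path. -/
lemma HasOscillations.comp_nat {x : T → E} {c : ℝ} {g : ℕ → T} (hg : Monotone g) {p k : ℕ}
    (h : HasOscillations x c (Set.range g) p (g k)) :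
    HasOscillations (x ∘ g) c Set.univ p k := by
  induction p generalizing k with
  | zero => trivial
  | succ p ih =>
    obtain ⟨_, ⟨i, rfl⟩, _, ⟨j, rfl⟩, huv, hvr, hp, hc⟩ := h
    have hij : i < j := hg.reflect_lt huv
    have hik : i < k := hg.reflect_lt (huv.trans_le hvr)
    -- if `j` exceeds `k`, then `g j = g k` and `j` may be replaced by `k`
    have hj : g (min j k) = g j := by
      rcases le_total j k with hjk | hjk
      · rw [min_eq_left hjk]
      · rw [min_eq_right hjk]
        exact le_antisymm (hg hjk) hvr
    refine ⟨i, trivial, min j k, trivial, lt_min hij hik, min_le_right _ _, ih hp, ?_⟩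
    simpa [hj] using hc

end Oscillations

/-! ### Sequences with independent increments -/

section Discrete

variable {Ω E : Type*} [NormedAddCommGroup E] [MeasurableSpace E]

/-- The σ-algebra generated by the increments `S (i + 1) - S i`, `i ∈ I`. -/
abbrev incrementAlgebra (S : ℕ → Ω → E) (I : Set ℕ) : MeasurableSpace Ω :=
  ⨆ i ∈ I, MeasurableSpace.comap (fun ω ↦ S (i + 1) ω - S i ω) inferInstance

variable {S : ℕ → Ω → E}

lemma incrementAlgebra_mono {I J : Set ℕ} (h : I ⊆ J) :
    incrementAlgebra S I ≤ incrementAlgebra S J :=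
  biSup_mono fun _ hi ↦ h hi

variable [BorelSpace E] [SecondCountableTopology E]

lemma measurable_sub_incrementAlgebra {I : Set ℕ} {i j : ℕ} (hij : i ≤ j)
    (hI : Set.Ico i j ⊆ I) : Measurable[incrementAlgebra S I] (fun ω ↦ S j ω - S i ω) := by
  induction j, hij using Nat.le_induction with
  | base => simp
  | succ j hij ih =>
    have h1 : Measurable[incrementAlgebra S I] (fun ω ↦ S (j + 1) ω - S j ω) :=
      (Measurable.of_comap_le le_rfl).mono
        (le_iSup₂_of_le (f := fun i (_ : i ∈ I) ↦ MeasurableSpace.comap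
          (fun ω ↦ S (i + 1) ω - S i ω) inferInstance) j (hI ⟨hij, j.lt_succ_self⟩) le_rfl) le_rfl
    have h2 := ih ((Set.Ico_subset_Ico_right j.le_succ).trans hI)
    have h3 := Measurable.add (m := incrementAlgebra S I) h1 h2
    rwa [show ((fun ω ↦ S (j + 1) ω - S j ω) + fun ω ↦ S j ω - S i ω) =
      fun ω ↦ S (j + 1) ω - S i ω by ext; simp] at h3

lemma measurableSet_lt_dist_incrementAlgebra {I : Set ℕ} {i j : ℕ} (c : ℝ) (hij : i ≤ j)
    (hI : Set.Ico i j ⊆ I) :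
    MeasurableSet[incrementAlgebra S I] {ω | c < dist (S i ω) (S j ω)} := by
  have h := measurable_sub_incrementAlgebra (S := S) hij hI
  have : {ω | c < dist (S i ω) (S j ω)} = (fun ω ↦ S j ω - S i ω) ⁻¹' {z | c < ‖z‖} := by
    ext ω
    simp [dist_eq_norm_sub']
  rw [this]
  exact h (measurableSet_lt measurable_const measurable_norm)

lemma measurableSet_hasOscillations (c : ℝ) (p k : ℕ) :
    MeasurableSet[incrementAlgebra S (Set.Iio k)]
      {ω | HasOscillations (fun i ↦ S i ω) c Set.univ p k} := by
  induction p generalizing k with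
  | zero => simp [HasOscillations]
  | succ p ih =>
    have : {ω | HasOscillations (fun i ↦ S i ω) c Set.univ (p + 1) k} =
        ⋃ (u : ℕ) (v : ℕ) (_ : u < v) (_ : v ≤ k),
          {ω | HasOscillations (fun i ↦ S i ω) c Set.univ p u} ∩
            {ω | c < dist (S u ω) (S v ω)} := by
      ext ω
      simp only [HasOscillations, Set.mem_univ, true_and, Set.mem_ofPred_eq, Set.mem_iUnion,
        Set.mem_inter_iff, exists_prop]
    rw [this]
    refine MeasurableSet.iUnion fun u ↦ MeasurableSet.iUnion fun v ↦ MeasurableSet.iUnion fun huv ↦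
      MeasurableSet.iUnion fun hvk ↦ MeasurableSet.inter ?_ ?_
    · exact incrementAlgebra_mono (Set.Iio_subset_Iio (huv.le.trans hvk)) _ (ih u)
    · exact measurableSet_lt_dist_incrementAlgebra c huv.le fun i hi ↦ hi.2.trans_le hvk

variable [mΩ : MeasurableSpace Ω] {P : Measure Ω}

lemma incrementAlgebra_le (hS : ∀ i, Measurable (S i)) (I : Set ℕ) :
    incrementAlgebra S I ≤ mΩ :=
  iSup₂_le fun i _ ↦ ((hS (i + 1)).sub (hS i)).comap_le

lemma indep_incrementAlgebra (hS : ∀ i, Measurable (S i))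
    (hind : iIndepFun (fun i ω ↦ S (i + 1) ω - S i ω) P) {I J : Set ℕ} (hIJ : Disjoint I J) :
    Indep (incrementAlgebra S I) (incrementAlgebra S J) P :=
  indep_iSup_of_disjoint (fun i ↦ ((hS (i + 1)).sub (hS i)).comap_le) hind hIJ

/-- If `A k` is determined by the increments before time `k` and `B k` by those after `k`, then the
probability that `B` occurs at the first time at which `A` occurs is at most the largest `P (B k)`
times the probability that `A` occurs at all. -/
lemma measure_first_hit_le (hS : ∀ i, Measurable (S i))
    (hind : iIndepFun (fun i ω ↦ S (i + 1) ω - S i ω) P) (m : ℕ) {A B : ℕ → Set Ω}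
    (hA : ∀ k, MeasurableSet[incrementAlgebra S (Set.Iio k)] (A k))
    (hB : ∀ k, MeasurableSet[incrementAlgebra S (Set.Ici k)] (B k))
    {a : ENNReal} (ha : ∀ k ≤ m, P (B k) ≤ a) :
    P {ω | ∃ k ≤ m, ω ∈ A k ∧ (∀ j < k, ω ∉ A j) ∧ ω ∈ B k} ≤ a * P {ω | ∃ k ≤ m, ω ∈ A k} := by
  let F : ℕ → Set Ω := fun k ↦ A k ∩ ⋂ j, ⋂ (_ : j < k), (A j)ᶜ
  have hF : ∀ k, MeasurableSet[incrementAlgebra S (Set.Iio k)] (F k) := fun k ↦ by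
    refine MeasurableSet.inter (hA k)
      (MeasurableSet.iInter fun j ↦ MeasurableSet.iInter fun hj ↦ ?_)
    exact (incrementAlgebra_mono (Set.Iio_subset_Iio hj.le) _ (hA j)).compl
  have hF' : ∀ k, MeasurableSet (F k) := fun k ↦ incrementAlgebra_le hS _ _ (hF k)
  have hdisj : Pairwise (Function.onFun Disjoint F) := by
    intro i j hij
    refine Set.disjoint_left.2 fun ω hi hj ↦ ?_
    simp only [F, Set.mem_inter_iff, Set.mem_iInter, Set.mem_compl_iff] at hi hj
    rcases lt_or_gt_of_ne hij with h | h
    · exact hj.2 i h hi.1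
    · exact hi.2 j h hj.1
  calc P {ω | ∃ k ≤ m, ω ∈ A k ∧ (∀ j < k, ω ∉ A j) ∧ ω ∈ B k}
      ≤ P (⋃ k ∈ Finset.range (m + 1), F k ∩ B k) := by
        refine measure_mono ?_
        rintro ω ⟨k, hk, h1, h2, h3⟩
        refine Set.mem_biUnion (x := k) (by simpa [Nat.lt_succ_iff] using hk) ?_
        simp only [F, Set.mem_inter_iff, Set.mem_iInter, Set.mem_compl_iff]
        exact ⟨⟨h1, h2⟩, h3⟩
    _ ≤ ∑ k ∈ Finset.range (m + 1), P (F k ∩ B k) := measure_biUnion_finset_le _ _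
    _ ≤ ∑ k ∈ Finset.range (m + 1), P (F k) * a := by
        refine Finset.sum_le_sum fun k hk ↦ ?_
        have hI := indep_incrementAlgebra hS hind (I := Set.Iio k) (J := Set.Ici k)
          (Set.disjoint_left.2 fun i (hi : i < k) (hi' : k ≤ i) ↦ (hi.trans_le hi').false)
        rw [Indep_iff] at hI
        rw [hI _ _ (hF k) (hB k)]
        gcongr
        exact ha k (Nat.lt_succ_iff.1 (Finset.mem_range.1 hk))
    _ = a * P (⋃ k ∈ Finset.range (m + 1), F k) := by
        rw [← Finset.sum_mul, mul_comm,
          measure_biUnion_finset (fun i _ j _ hij ↦ hdisj hij) fun k _ ↦ hF' k]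
    _ ≤ a * P {ω | ∃ k ≤ m, ω ∈ A k} := by
        gcongr
        intro ω hω
        obtain ⟨k, hk, h⟩ := Set.mem_iUnion₂.1 hω
        exact ⟨k, Nat.lt_succ_iff.1 (Finset.mem_range.1 hk), h.1⟩

/-- Ottaviani's maximal inequality: when `S j` is first at distance more than `2 * c` from `S k`,
either `S m` is still at distance more than `c` from `S k`, or it is at distance more than `c` from
`S j`, an event which is independent of the past. -/
lemma measure_exists_lt_dist_le [IsProbabilityMeasure P] (hS : ∀ i, Measurable (S i))
    (hind : iIndepFun (fun i ω ↦ S (i + 1) ω - S i ω) P) {c : ℝ} {a : ENNReal} {k m : ℕ}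
    (hkm : k ≤ m)
    (ha : ∀ i j, k ≤ i → i ≤ j → j ≤ m → P {ω | c < dist (S i ω) (S j ω)} ≤ a) :
    P {ω | ∃ j, k ≤ j ∧ j ≤ m ∧ 2 * c < dist (S k ω) (S j ω)} ≤ 2 * a := by
  classical
  let A : ℕ → Set Ω := fun j ↦ {ω | k ≤ j ∧ 2 * c < dist (S k ω) (S j ω)}
  let B : ℕ → Set Ω := fun j ↦ {ω | (k ≤ j ∧ j ≤ m) ∧ c < dist (S j ω) (S m ω)}
  have hA : ∀ j, MeasurableSet[incrementAlgebra S (Set.Iio j)] (A j) := fun j ↦ by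
    by_cases hj : k ≤ j
    · simpa [A, hj] using measurableSet_lt_dist_incrementAlgebra (S := S) (2 * c) hj
        (I := Set.Iio j) fun i hi ↦ hi.2
    · simp [A, hj]
  have hB : ∀ j, MeasurableSet[incrementAlgebra S (Set.Ici j)] (B j) := fun j ↦ by
    by_cases hj : k ≤ j ∧ j ≤ m
    · simpa [B, hj] using measurableSet_lt_dist_incrementAlgebra (S := S) c hj.2
        (I := Set.Ici j) fun i hi ↦ hi.1
    · simp [B, hj]
  have hBa : ∀ j ≤ m, P (B j) ≤ a := fun j hjm ↦ by
    by_cases hj : k ≤ j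
    · simpa [B, hj, hjm] using ha j m hj hjm le_rfl
    · simp [B, hj]
  calc P {ω | ∃ j, k ≤ j ∧ j ≤ m ∧ 2 * c < dist (S k ω) (S j ω)}
      ≤ P ({ω | c < dist (S k ω) (S m ω)} ∪
          {ω | ∃ j ≤ m, ω ∈ A j ∧ (∀ i < j, ω ∉ A i) ∧ ω ∈ B j}) := by
        refine measure_mono ?_
        rintro ω ⟨j, hkj, hjm, hd⟩
        by_cases hc : c < dist (S k ω) (S m ω)
        · exact Or.inl hc
        right
        have hex : ∃ j, ω ∈ A j := ⟨j, hkj, hd⟩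
        have hle : Nat.find hex ≤ m := (Nat.find_min' hex ⟨hkj, hd⟩).trans hjm
        have hmem := Nat.find_spec hex
        refine ⟨Nat.find hex, hle, hmem, fun i hi ↦ Nat.find_min hex hi, ⟨hmem.1, hle⟩, ?_⟩
        have h1 := hmem.2
        have h2 := dist_triangle_right (S k ω) (S (Nat.find hex) ω) (S m ω)
        linarith
    _ ≤ a + a * 1 := by
        refine (measure_union_le _ _).trans (add_le_add (ha k m le_rfl hkm le_rfl) ?_)
        refine (measure_first_hit_le hS hind m hA hB hBa).trans ?_
        gcongr
        exact prob_le_one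
    _ = 2 * a := by rw [mul_one, two_mul]

/-- The probability of `p` oscillations decays geometrically in `p`: after the first time at which
`p` oscillations are completed, the next oscillation is independent of the past and is controlled
by Ottaviani's inequality. -/
lemma measure_hasOscillations_le [IsProbabilityMeasure P] (hS : ∀ i, Measurable (S i))
    (hind : iIndepFun (fun i ω ↦ S (i + 1) ω - S i ω) P) {c : ℝ} {a : ENNReal} {m : ℕ}
    (ha : ∀ i j, i ≤ j → j ≤ m → P {ω | c < dist (S i ω) (S j ω)} ≤ a) (p : ℕ) :
    P {ω | HasOscillations (fun i ↦ S i ω) (4 * c) Set.univ p m} ≤ (2 * a) ^ p := by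
  classical
  induction p with
  | zero => simpa using prob_le_one
  | succ p ih =>
    let A : ℕ → Set Ω := fun k ↦ {ω | HasOscillations (fun i ↦ S i ω) (4 * c) Set.univ p k}
    let B : ℕ → Set Ω := fun k ↦
      {ω | ∃ i j, k ≤ i ∧ i < j ∧ j ≤ m ∧ 4 * c < dist (S i ω) (S j ω)}
    have hA : ∀ k, MeasurableSet[incrementAlgebra S (Set.Iio k)] (A k) :=
      fun k ↦ measurableSet_hasOscillations (4 * c) p k
    have hB : ∀ k, MeasurableSet[incrementAlgebra S (Set.Ici k)] (B k) := fun k ↦ by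
      have : B k = ⋃ (i : ℕ) (j : ℕ) (_ : k ≤ i) (_ : i < j) (_ : j ≤ m),
          {ω | 4 * c < dist (S i ω) (S j ω)} := by
        ext ω
        simp only [B, Set.mem_ofPred_eq, Set.mem_iUnion, exists_prop]
      rw [this]
      refine MeasurableSet.iUnion fun i ↦ MeasurableSet.iUnion fun j ↦ MeasurableSet.iUnion
        fun hki ↦ MeasurableSet.iUnion fun hij ↦ MeasurableSet.iUnion fun _ ↦ ?_
      exact measurableSet_lt_dist_incrementAlgebra _ hij.le fun l hl ↦ hki.trans hl.1
    have hBa : ∀ k ≤ m, P (B k) ≤ 2 * a := fun k hkm ↦ by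
      refine (measure_mono ?_).trans (measure_exists_lt_dist_le hS hind hkm
        fun i j _ hij hjm ↦ ha i j hij hjm)
      rintro ω ⟨i, j, hki, hij, hjm, hd⟩
      by_contra hcon
      have h1 : ∀ l, k ≤ l → l ≤ m → dist (S k ω) (S l ω) ≤ 2 * c := fun l hl hlm ↦
        not_lt.1 fun h ↦ hcon ⟨l, hl, hlm, h⟩
      have h2 := h1 i hki (hij.le.trans hjm)
      have h3 := h1 j (hki.trans hij.le) hjm
      have h4 := dist_triangle_left (S i ω) (S j ω) (S k ω)
      linarith
    calc P {ω | HasOscillations (fun i ↦ S i ω) (4 * c) Set.univ (p + 1) m}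
        ≤ P {ω | ∃ k ≤ m, ω ∈ A k ∧ (∀ j < k, ω ∉ A j) ∧ ω ∈ B k} := by
          refine measure_mono ?_
          rintro ω ⟨i, -, j, -, hij, hjm, hp, hd⟩
          have hex : ∃ k, ω ∈ A k := ⟨i, hp⟩
          have hki : Nat.find hex ≤ i := Nat.find_min' hex hp
          exact ⟨Nat.find hex, hki.trans (hij.le.trans hjm), Nat.find_spec hex,
            fun l hl ↦ Nat.find_min hex hl, i, j, hki, hij, hjm, hd⟩
      _ ≤ 2 * a * P {ω | ∃ k ≤ m, ω ∈ A k} := measure_first_hit_le hS hind m hA hB hBa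
      _ ≤ 2 * a * (2 * a) ^ p := by
          gcongr
          refine (measure_mono ?_).trans ih
          rintro ω ⟨k, hk, h⟩
          exact HasOscillations.mono subset_rfl hk h
      _ = (2 * a) ^ (p + 1) := by rw [pow_succ']

end Discrete

/-! ### One-sided limits from finitely many oscillations -/

section Paths

variable {E : Type*} [MetricSpace E]

/-- A path which makes only finitely many oscillations of each size along `D` near `t` has a
right limit at `t` along `D`. -/
lemma exists_tendsto_right_of_not_hasOscillations [CompleteSpace E] {x : ℝ≥0 → E} {D : Set ℝ≥0}
    {t : ℝ≥0} [NeBot (𝓝[D ∩ Set.Ioi t] t)]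
    (H : ∀ c > 0, ∃ a b p, Set.Icc a b ∈ 𝓝 t ∧ ¬ HasOscillations x c (D ∩ Set.Icc a b) p b) :
    ∃ l, Tendsto x (𝓝[D ∩ Set.Ioi t] t) (𝓝 l) := by
  refine cauchy_map_iff_exists_tendsto.1 (Metric.cauchy_iff.2 ⟨inferInstance, fun ε hε ↦ ?_⟩)
  by_contra hcon
  obtain ⟨a, b, p, hab, hosc⟩ := H (ε / 2) (by positivity)
  have hat : a ≤ t := (mem_of_mem_nhds hab).1
  have htb : t < b := by
    obtain ⟨u, hu, hub⟩ := exists_Ico_subset_of_mem_nhds hab (exists_gt t)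
    obtain ⟨v, hv, hvu⟩ := exists_between hu
    exact hv.trans_le (hub ⟨hv.le, hvu⟩).2
  -- arbitrarily close to `t` on the right there is an oscillation, hence any number of them
  have key : ∀ r, t < r → ∃ u ∈ D ∩ Set.Ioc t r, ∃ v ∈ D ∩ Set.Ioc t r, u < v ∧
      ε / 2 < dist (x u) (x v) := by
    intro r hr
    by_contra hno
    refine hcon ⟨x '' (D ∩ Set.Ioc t r), image_mem_map ?_, ?_⟩
    · have : Set.Iio r ∈ 𝓝 t := Iio_mem_nhds hr
      filter_upwards [mem_nhdsWithin_of_mem_nhds this, self_mem_nhdsWithin] with u hu hu'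
      exact ⟨hu'.1, hu'.2, hu.le⟩
    · rintro _ ⟨u, hu, rfl⟩ _ ⟨v, hv, rfl⟩
      by_contra hd
      have hd' : ε / 2 < dist (x u) (x v) := by linarith
      rcases lt_trichotomy u v with h | h | h
      · exact hno ⟨u, hu, v, hv, h, hd'⟩
      · rw [h, dist_self] at hd'
        linarith
      · exact hno ⟨v, hv, u, hu, h, by rwa [dist_comm]⟩
  have hall : ∀ p r, t < r → HasOscillations x (ε / 2) (D ∩ Set.Ioc t r) p r := by
    intro p
    induction p with
    | zero => exact fun _ _ ↦ trivial
    | succ p ih =>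
      intro r hr
      obtain ⟨u, hu, v, hv, huv, hd⟩ := key r hr
      exact ⟨u, hu, v, hv, huv, hv.2.2, (ih u hu.2.1).mono
        (Set.inter_subset_inter_right _ (Set.Ioc_subset_Ioc_right hu.2.2)) le_rfl, hd⟩
  have hsub : Set.Ioc t b ⊆ Set.Icc a b := fun u hu ↦ ⟨hat.trans hu.1.le, hu.2⟩
  exact hosc ((hall p b htb).mono (Set.inter_subset_inter_right _ hsub) le_rfl)

/-- A path which makes only finitely many oscillations of each size along `D` near `t` has a
left limit at `t` along `D`. -/
lemma exists_tendsto_left_of_not_hasOscillations [CompleteSpace E] {x : ℝ≥0 → E} {D : Set ℝ≥0}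
    {t : ℝ≥0} (ht : 0 < t) [NeBot (𝓝[D ∩ Set.Iio t] t)]
    (H : ∀ c > 0, ∃ a b p, Set.Icc a b ∈ 𝓝 t ∧ ¬ HasOscillations x c (D ∩ Set.Icc a b) p b) :
    ∃ l, Tendsto x (𝓝[D ∩ Set.Iio t] t) (𝓝 l) := by
  refine cauchy_map_iff_exists_tendsto.1 (Metric.cauchy_iff.2 ⟨inferInstance, fun ε hε ↦ ?_⟩)
  by_contra hcon
  obtain ⟨a, b, p, hab, hosc⟩ := H (ε / 2) (by positivity)
  have htb : t ≤ b := (mem_of_mem_nhds hab).2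
  have hat : a < t := by
    obtain ⟨u, hu, hub⟩ := exists_Ioc_subset_of_mem_nhds hab ⟨0, ht⟩
    obtain ⟨v, hv, hvu⟩ := exists_between hu
    exact (hub ⟨hv, hvu.le⟩).1.trans_lt hvu
  -- arbitrarily close to `t` on the left there is an oscillation, hence any number of them
  have key : ∀ r, r < t → ∃ u ∈ D ∩ Set.Ico r t, ∃ v ∈ D ∩ Set.Ico r t, u < v ∧
      ε / 2 < dist (x u) (x v) := by
    intro r hr
    by_contra hno
    refine hcon ⟨x '' (D ∩ Set.Ico r t), image_mem_map ?_, ?_⟩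
    · have : Set.Ioi r ∈ 𝓝 t := Ioi_mem_nhds hr
      filter_upwards [mem_nhdsWithin_of_mem_nhds this, self_mem_nhdsWithin] with u hu hu'
      exact ⟨hu'.1, hu.le, hu'.2⟩
    · rintro _ ⟨u, hu, rfl⟩ _ ⟨v, hv, rfl⟩
      by_contra hd
      have hd' : ε / 2 < dist (x u) (x v) := by linarith
      rcases lt_trichotomy u v with h | h | h
      · exact hno ⟨u, hu, v, hv, h, hd'⟩
      · rw [h, dist_self] at hd'
        linarith
      · exact hno ⟨v, hv, u, hu, h, by rwa [dist_comm]⟩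
  have hall : ∀ p, ∃ r, a ≤ r ∧ r < t ∧ HasOscillations x (ε / 2) (D ∩ Set.Ico a t) p r := by
    intro p
    induction p with
    | zero => exact ⟨a, le_rfl, hat, trivial⟩
    | succ p ih =>
      obtain ⟨r, har, hrt, hp⟩ := ih
      obtain ⟨u, hu, v, hv, huv, hd⟩ := key r hrt
      exact ⟨v, har.trans hv.2.1, hv.2.2, u, ⟨hu.1, har.trans hu.2.1, hu.2.2⟩,
        v, ⟨hv.1, har.trans hv.2.1, hv.2.2⟩, huv, le_rfl, hp.mono subset_rfl hu.2.1, hd⟩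
  obtain ⟨r, -, hrt, hp⟩ := hall p
  have hsub : Set.Ico a t ⊆ Set.Icc a b := fun u hu ↦ ⟨hu.1, hu.2.le.trans htb⟩
  exact hosc (hp.mono (Set.inter_subset_inter_right _ hsub) (hrt.le.trans htb))

/-- If `y` collects the right limits of `x` along `D`, then the limit of `x` along `D`, from any
open side `G` of `t`, is also the limit of `y`. -/
lemma tendsto_of_right_limits {x y : ℝ≥0 → E} {D G : Set ℝ≥0}
    [∀ u, NeBot (𝓝[D ∩ Set.Ioi u] u)]
    (hy : ∀ u, Tendsto x (𝓝[D ∩ Set.Ioi u] u) (𝓝 (y u))) (hG : IsOpen G) {t : ℝ≥0} {l : E}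
    (hl : Tendsto x (𝓝[D ∩ G] t) (𝓝 l)) : Tendsto y (𝓝[G] t) (𝓝 l) := by
  refine (closed_nhds_basis l).tendsto_right_iff.2 fun V ⟨hV, hVc⟩ ↦ ?_
  obtain ⟨O, hO, htO, hOV⟩ := mem_nhdsWithin.1 (hl hV)
  refine mem_nhdsWithin.2 ⟨O, hO, htO, fun u hu ↦ ?_⟩
  refine hVc.mem_of_tendsto (hy u) ?_
  filter_upwards [mem_nhdsWithin_of_mem_nhds ((hO.inter hG).mem_nhds hu),
    self_mem_nhdsWithin] with s hs hs'
  exact hOV ⟨hs.1, hs'.1, hs.2⟩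

end Paths

lemma isCadlagPath_of_right_limits {E : Type*} [NormedAddCommGroup E] {x y : ℝ≥0 → E}
    {D : Set ℝ≥0} [∀ u, NeBot (𝓝[D ∩ Set.Ioi u] u)]
    (hy : ∀ u, Tendsto x (𝓝[D ∩ Set.Ioi u] u) (𝓝 (y u)))
    (hleft : ∀ t, 0 < t → ∃ l, Tendsto x (𝓝[D ∩ Set.Iio t] t) (𝓝 l)) : IsCadlagPath y :=
  ⟨fun t ↦ continuousWithinAt_Ioi_iff_Ici.1 (tendsto_of_right_limits hy isOpen_Ioi (hy t)),
    fun t ht ↦ (hleft t ht).imp fun _ ↦ tendsto_of_right_limits hy isOpen_Iio⟩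

/-! ### Dyadic times -/

/-- The dyadic times `j / 2 ^ n`. -/
def dyadics : Set ℝ≥0 := ⋃ n : ℕ, Set.range fun j : ℕ ↦ (j : ℝ≥0) / 2 ^ n

lemma countable_dyadics : dyadics.Countable :=
  Set.countable_iUnion fun _ ↦ Set.countable_range _

lemma zero_mem_dyadics : 0 ∈ dyadics := Set.mem_iUnion.2 ⟨0, 0, by simp⟩

lemma exists_dyadic_between {a b : ℝ≥0} (hab : a < b) : ∃ q ∈ dyadics, a < q ∧ q < b := by
  obtain ⟨n, hn⟩ := exists_pow_lt_of_lt_one (tsub_pos_of_lt hab) (by norm_num : (1 / 2 : ℝ≥0) < 1)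
  have h2 : (0 : ℝ≥0) < 2 ^ n := by positivity
  refine ⟨_, Set.mem_iUnion.2 ⟨n, ⌊a * 2 ^ n⌋₊ + 1, rfl⟩, ?_, ?_⟩
  · rw [lt_div_iff₀ h2]
    exact_mod_cast Nat.lt_floor_add_one _
  · have h3 : ((⌊a * 2 ^ n⌋₊ + 1 : ℕ) : ℝ≥0) ≤ a * 2 ^ n + 1 := by
      push_cast
      gcongr
      exact Nat.floor_le (zero_le)
    calc ((⌊a * 2 ^ n⌋₊ + 1 : ℕ) : ℝ≥0) / 2 ^ n ≤ (a * 2 ^ n + 1) / 2 ^ n := by gcongr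
      _ = a + (1 / 2) ^ n := by rw [add_div, mul_div_cancel_right₀ _ h2.ne', one_div_pow]
      _ < b := lt_tsub_iff_left.1 hn

lemma dense_dyadics : Dense dyadics :=
  dense_of_exists_between fun _ _ h ↦ exists_dyadic_between h

instance neBot_dyadics_right (t : ℝ≥0) : NeBot (𝓝[dyadics ∩ Set.Ioi t] t) := by
  rw [← mem_closure_iff_nhdsWithin_neBot, Set.inter_comm]
  refine closure_minimal (dense_dyadics.open_subset_closure_inter isOpen_Ioi) isClosed_closure ?_
  rw [closure_Ioi]
  exact Set.self_mem_Ici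

lemma neBot_dyadics_left {t : ℝ≥0} (ht : 0 < t) : NeBot (𝓝[dyadics ∩ Set.Iio t] t) := by
  rw [← mem_closure_iff_nhdsWithin_neBot, Set.inter_comm]
  refine closure_minimal (dense_dyadics.open_subset_closure_inter isOpen_Iio) isClosed_closure ?_
  rw [closure_Iio' (show (Set.Iio t).Nonempty from ⟨0, ht⟩)]
  exact Set.self_mem_Iic

/-- Every neighbourhood of `t` contains a neighbourhood `[a, b]` of `t` with dyadic endpoints. -/
lemma exists_dyadic_Icc_mem_nhds {t : ℝ≥0} {U : Set ℝ≥0} (hU : U ∈ 𝓝 t) :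
    ∃ a ∈ dyadics, ∃ b ∈ dyadics, Set.Icc a b ∈ 𝓝 t ∧ Set.Icc a b ⊆ U := by
  obtain ⟨u, hu, huU⟩ := exists_Ico_subset_of_mem_nhds hU (exists_gt t)
  obtain ⟨b, hb, htb, hbu⟩ := exists_dyadic_between hu
  rcases eq_or_ne t 0 with rfl | ht
  · refine ⟨0, zero_mem_dyadics, b, hb, ?_, fun s hs ↦ huU ⟨hs.1, hs.2.trans_lt hbu⟩⟩
    exact mem_of_superset (Iio_mem_nhds htb) fun s hs ↦ ⟨zero_le, hs.le⟩
  · obtain ⟨l, hl, hlU⟩ := exists_Ioc_subset_of_mem_nhds hU ⟨0, pos_iff_ne_zero.2 ht⟩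
    obtain ⟨a, ha, hla, hat⟩ := exists_dyadic_between hl
    refine ⟨a, ha, b, hb, Icc_mem_nhds hat htb, fun s hs ↦ ?_⟩
    rcases le_total s t with h | h
    · exact hlU ⟨hla.trans_le hs.1, h⟩
    · exact huU ⟨h, hs.2.trans_lt hbu⟩

/-! ### Càdlàg modifications -/

section Modification

variable {Ω E : Type*} [mΩ : MeasurableSpace Ω] [NormedAddCommGroup E] {P : Measure Ω}
  {Y : ℝ≥0 → Ω → E}

/-- Near any time, a stochastically continuous process is unlikely to make large increments. -/
lemma IsStochasticallyContinuous.exists_mem_nhds (hY : IsStochasticallyContinuous Y P) (t : ℝ≥0)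
    {c : ℝ} (hc : 0 < c) :
    ∃ U ∈ 𝓝 t, ∀ s ∈ U, ∀ s' ∈ U, P {ω | c < dist (Y s ω) (Y s' ω)} ≤ 1 / 4 := by
  have h := tendstoInMeasure_iff_dist.1 (hY t) (c / 2) (by positivity)
  refine ⟨_, h (Iio_mem_nhds (by simp : (0 : ENNReal) < 1 / 8)), fun s hs s' hs' ↦ ?_⟩
  calc P {ω | c < dist (Y s ω) (Y s' ω)}
      ≤ P ({ω | c / 2 ≤ dist (Y s ω) (Y t ω)} ∪ {ω | c / 2 ≤ dist (Y s' ω) (Y t ω)}) := by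
        refine measure_mono fun ω (hω : c < _) ↦ ?_
        by_contra hcon
        simp only [Set.mem_union, Set.mem_ofPred_eq, not_or, not_le] at hcon
        have := dist_triangle_right (Y s ω) (Y s' ω) (Y t ω)
        linarith [hcon.1, hcon.2]
    _ ≤ 1 / 8 + 1 / 8 := (measure_union_le _ _).trans (add_le_add hs.le hs'.le)
    _ = 1 / 4 := by
        rw [← ENNReal.toReal_eq_toReal_iff' (by finiteness) (by finiteness)]
        rw [ENNReal.toReal_add (by finiteness) (by finiteness)]
        norm_num

variable [MeasurableSpace E] [BorelSpace E] [SecondCountableTopology E]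

/-- If no increment within `[a, b]` is likely to exceed `c`, then almost every path makes finitely
many oscillations of size `4 * c` along the dyadic times in `[a, b]`. -/
lemma ae_exists_not_hasOscillations [IsProbabilityMeasure P] (hY : ∀ t, Measurable (Y t))
    (hind : HasIndepIncrements Y P) {a b : ℝ≥0} (hab : a ≤ b) {c : ℝ}
    (hc : ∀ s ∈ Set.Icc a b, ∀ t ∈ Set.Icc a b, P {ω | c < dist (Y s ω) (Y t ω)} ≤ 1 / 4) :
    ∀ᵐ ω ∂P, ∃ p, ¬ HasOscillations (fun t ↦ Y t ω) (4 * c) (dyadics ∩ Set.Icc a b) p b := by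
  -- the grid of mesh `2⁻ⁿ`, clamped to `[a, b]`
  let g : ℕ → ℕ → ℝ≥0 := fun n j ↦ max a (min ((j : ℝ≥0) / 2 ^ n) b)
  have hg : ∀ n, Monotone (g n) := fun n i j hij ↦ by
    simp only [g]
    gcongr
  have hgab : ∀ n j, g n j ∈ Set.Icc a b := fun n j ↦
    ⟨le_max_left _ _, max_le hab (min_le_right _ _)⟩
  have hrange : Monotone fun n ↦ Set.range (g n) := by
    refine monotone_nat_of_le_succ fun n ↦ ?_
    rintro _ ⟨j, rfl⟩
    refine ⟨j * 2, ?_⟩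
    simp only [g]
    congr 2
    push_cast
    rw [pow_succ, mul_div_mul_right _ _ two_ne_zero]
  have hsub : dyadics ∩ Set.Icc a b ⊆ ⋃ n, Set.range (g n) := by
    rintro s ⟨hs, has, hsb⟩
    obtain ⟨n, j, rfl⟩ := Set.mem_iUnion.1 hs
    refine Set.mem_iUnion.2 ⟨n, j, ?_⟩
    simp only [g]
    rw [min_eq_left hsb, max_eq_right has]
  have hb : ∀ n, ∃ m, g n m = b := fun n ↦ by
    obtain ⟨m, hm⟩ := exists_nat_ge (b * 2 ^ n)
    refine ⟨m, ?_⟩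
    simp only [g]
    rw [min_eq_right ((le_div_iff₀ (by positivity)).2 hm), max_eq_right hab]
  have hbound : ∀ p, P {ω | ∀ p, HasOscillations (fun t ↦ Y t ω) (4 * c)
      (dyadics ∩ Set.Icc a b) p b} ≤ (1 / 2) ^ p := fun p ↦ by
    calc P {ω | ∀ p, HasOscillations (fun t ↦ Y t ω) (4 * c) (dyadics ∩ Set.Icc a b) p b}
        ≤ P (⋃ n, {ω | HasOscillations (fun t ↦ Y t ω) (4 * c) (Set.range (g n)) p b}) := by
          refine measure_mono fun ω hω ↦ Set.mem_iUnion.2 ?_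
          exact ((hω p).mono hsub le_rfl).exists_of_iUnion hrange
      _ = ⨆ n, P {ω | HasOscillations (fun t ↦ Y t ω) (4 * c) (Set.range (g n)) p b} := by
          refine Monotone.measure_iUnion fun n m hnm ω hω ↦ ?_
          exact HasOscillations.mono (hrange hnm) le_rfl hω
      _ ≤ (1 / 2) ^ p := by
          refine iSup_le fun n ↦ ?_
          obtain ⟨m, hm⟩ := hb n
          have h := measure_hasOscillations_le (S := fun j ↦ Y (g n j)) (m := m) (c := c)
            (a := 1 / 4) (fun j ↦ hY _) (hind.nat (hg n))
            (fun i j _ _ ↦ hc _ (hgab n i) _ (hgab n j)) p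
          rw [show (2 : ENNReal) * (1 / 4) = 1 / 2 by
            rw [← ENNReal.toReal_eq_toReal_iff' (by finiteness) (by finiteness)]
            norm_num] at h
          refine (measure_mono fun ω hω ↦ ?_).trans h
          rw [← hm] at hω
          exact HasOscillations.comp_nat (hg n) hω
  have hzero : P {ω | ∀ p, HasOscillations (fun t ↦ Y t ω) (4 * c)
      (dyadics ∩ Set.Icc a b) p b} = 0 :=
    le_zero_iff.1 (ge_of_tendsto' (ENNReal.tendsto_pow_atTop_nhds_zero_of_lt_one
      (by simp : (1 / 2 : ENNReal) < 1)) hbound)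
  rw [ae_iff]
  simpa using hzero

/-- A stochastically continuous process with independent increments has a càdlàg modification. -/
theorem exists_cadlag_modification [CompleteSpace E] [IsProbabilityMeasure P]
    (hY : ∀ t, Measurable (Y t)) (hind : HasIndepIncrements Y P)
    (hcont : IsStochasticallyContinuous Y P) :
    ∃ L : ℝ≥0 → Ω → E, (∀ t, Measurable (L t)) ∧ (∀ᵐ ω ∂P, IsCadlagPath fun t ↦ L t ω) ∧
      ∀ t, L t =ᵐ[P] Y t := by
  have hfin : ∀ᵐ ω ∂P, ∀ t, ∀ c > 0, ∃ a b p, Set.Icc a b ∈ 𝓝 t ∧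
      ¬ HasOscillations (fun t ↦ Y t ω) c (dyadics ∩ Set.Icc a b) p b := by
    have : ∀ᵐ ω ∂P, ∀ k : ℕ, ∀ a ∈ dyadics, ∀ b ∈ dyadics, a ≤ b →
        (∀ s ∈ Set.Icc a b, ∀ t ∈ Set.Icc a b,
          P {ω | 1 / ((k : ℝ) + 1) < dist (Y s ω) (Y t ω)} ≤ 1 / 4) →
        ∃ p, ¬ HasOscillations (fun t ↦ Y t ω) (4 * (1 / ((k : ℝ) + 1)))
          (dyadics ∩ Set.Icc a b) p b := by
      refine ae_all_iff.2 fun k ↦ (ae_ball_iff countable_dyadics).2 fun a _ ↦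
        (ae_ball_iff countable_dyadics).2 fun b _ ↦ ?_
      by_cases h : a ≤ b ∧ ∀ s ∈ Set.Icc a b, ∀ t ∈ Set.Icc a b,
          P {ω | 1 / ((k : ℝ) + 1) < dist (Y s ω) (Y t ω)} ≤ 1 / 4
      · filter_upwards [ae_exists_not_hasOscillations hY hind h.1 h.2] with ω hω _ _ using hω
      · exact ae_of_all _ fun ω h1 h2 ↦ absurd ⟨h1, h2⟩ h
    filter_upwards [this] with ω hω t c hc
    obtain ⟨k, hk⟩ := exists_nat_one_div_lt (show 0 < c / 4 by positivity)
    obtain ⟨U, hU, hUc⟩ := hcont.exists_mem_nhds t (c := 1 / ((k : ℝ) + 1)) (by positivity)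
    obtain ⟨a, ha, b, hb, hab, habU⟩ := exists_dyadic_Icc_mem_nhds hU
    have hmem := mem_of_mem_nhds hab
    obtain ⟨p, hp⟩ := hω k a ha b hb (hmem.1.trans hmem.2)
      fun s hs s' hs' ↦ hUc s (habU hs) s' (habU hs')
    exact ⟨a, b, p, hab, fun h ↦ hp (h.of_size_le (by linarith))⟩
  -- the limit along one sequence is measurable in `ω`, whether or not it exists
  choose d hd using fun t : ℝ≥0 ↦ exists_seq_tendsto (𝓝[dyadics ∩ Set.Ioi t] t)
  let L : ℝ≥0 → Ω → E := fun t ω ↦ limUnder atTop fun n ↦ Y (d t n) ω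
  have hL : ∀ᵐ ω ∂P, ∀ t, Tendsto (fun s ↦ Y s ω) (𝓝[dyadics ∩ Set.Ioi t] t) (𝓝 (L t ω)) := by
    filter_upwards [hfin] with ω hω t
    obtain ⟨l, hl⟩ := exists_tendsto_right_of_not_hasOscillations (hω t)
    rwa [show L t ω = l from (hl.comp (hd t)).limUnder_eq]
  refine ⟨L, fun t ↦ ?_, ?_, fun t ↦ ?_⟩
  · exact (StronglyMeasurable.limUnder fun n ↦ (hY (d t n)).stronglyMeasurable).measurable
  · filter_upwards [hL, hfin] with ω hω hω'
    refine isCadlagPath_of_right_limits hω fun t ht ↦ ?_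
    have := neBot_dyadics_left ht
    exact exists_tendsto_left_of_not_hasOscillations ht (hω' t)
  · have h1 : TendstoInMeasure P (fun n ↦ Y (d t n)) atTop (L t) :=
      tendstoInMeasure_of_tendsto_ae (fun n ↦ (hY _).aestronglyMeasurable) <| by
        filter_upwards [hL] with ω hω using (hω t).comp (hd t)
    have h2 : TendstoInMeasure P (fun n ↦ Y (d t n)) atTop (Y t) :=
      (hcont t).comp ((hd t).mono_right nhdsWithin_le_nhds)
    exact tendstoInMeasure_ae_unique h1 h2

end Modification

/-! ### Stationarity of the increments -/

section Stationary

variable {Ω E : Type*} [mΩ : MeasurableSpace Ω] [NormedAddCommGroup E] [InnerProductSpace ℝ E]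
  [MeasurableSpace E] [BorelSpace E] {P : Measure Ω} [IsProbabilityMeasure P] {Y : ℝ≥0 → Ω → E}

lemma charFun_map_zero (hzero : ∀ᵐ ω ∂P, Y 0 ω = 0) (ξ : E) : charFun (P.map (Y 0)) ξ = 1 := by
  rw [Measure.map_congr (g := fun _ ↦ (0 : E)) hzero]
  simp [Measure.map_const, charFun_dirac]

variable [FiniteDimensional ℝ E]

lemma IsStochasticallyContinuous.continuous_charFun (hY : ∀ t, Measurable (Y t))
    (hcont : IsStochasticallyContinuous Y P) (ξ : E) :
    Continuous fun t ↦ charFun (P.map (Y t)) ξ := by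
  refine continuous_iff_continuousAt.2 fun t ↦ tendsto_of_seq_tendsto fun u hu ↦ ?_
  have h := (((hcont t).comp hu).tendstoInDistribution fun n ↦ (hY (u n)).aemeasurable).tendsto
  exact ProbabilityMeasure.tendsto_iff_tendsto_charFun.1 h ξ

/-- A probability measure which equals its own convolution square is the Dirac mass at `0`: its
characteristic function is continuous and takes only the values `0` and `1`. -/
lemma eq_dirac_zero_of_charFun_eq_sq {μ : Measure E} [IsProbabilityMeasure μ]
    (h : ∀ ξ, charFun μ ξ = charFun μ ξ ^ 2) : μ = Measure.dirac 0 := by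
  have hc : Continuous (charFun μ) := MeasureTheory.continuous_charFun
  have h01 : ∀ ξ, charFun μ ξ = 0 ∨ charFun μ ξ = 1 := fun ξ ↦ by
    have : charFun μ ξ * (charFun μ ξ - 1) = 0 := by linear_combination -(h ξ)
    exact (mul_eq_zero.1 this).imp_right sub_eq_zero.1
  have hclopen : IsClopen {ξ | charFun μ ξ = 1} := by
    refine ⟨isClosed_eq hc continuous_const, ?_⟩
    have : {ξ | charFun μ ξ = 1} = {ξ | charFun μ ξ ≠ 0} := by
      ext ξ
      rcases h01 ξ with h | h <;> simp [h]
    rw [this]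
    exact isOpen_ne_fun hc continuous_const
  have huniv := hclopen.eq_univ ⟨0, by simp⟩
  refine Measure.ext_of_charFun (funext fun ξ ↦ ?_)
  have : ξ ∈ {ξ | charFun μ ξ = 1} := huniv ▸ Set.mem_univ ξ
  simpa [charFun_dirac] using this

/-- Run with the clock `t ↦ t ^ (1 / α)`, an `α`-IDT process has at time `n * t` the `n`-th
convolution power of its law at time `t`. -/
lemma IsAlphaIDT.charFun_eq_pow {α : ℝ} {X : ℝ≥0 → Ω → E} (hX : ∀ t, Measurable (X t))
    (h : IsAlphaIDT α X P) {n : ℕ} (hn : 0 < n) (t : ℝ≥0) (ξ : E) :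
    charFun (P.map (X ((n * t) ^ (1 / α)))) ξ = charFun (P.map (X (t ^ (1 / α)))) ξ ^ n := by
  have h1 := ((h n hn).comp (measurable_pi_apply (t ^ (1 / α)))).map_eq
  have h2 : P.map (X ((n * t) ^ (1 / α))) =
      (Measure.pi fun _ : Fin n ↦ P).map fun ω ↦ ∑ i, X (t ^ (1 / α)) (ω i) := by
    rw [NNReal.mul_rpow]
    exact h1
  have hind : iIndepFun (fun (i : Fin n) (ω : Fin n → Ω) ↦ X (t ^ (1 / α)) (ω i))
      (Measure.pi fun _ : Fin n ↦ P) :=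
    iIndepFun_pi (X := fun _ ↦ X (t ^ (1 / α))) fun _ ↦ (hX _).aemeasurable
  have hmap : ∀ i : Fin n, (Measure.pi fun _ : Fin n ↦ P).map
      (fun ω ↦ X (t ^ (1 / α)) (ω i)) = P.map (X (t ^ (1 / α))) := fun i ↦ by
    have := (measurePreserving_eval (fun _ : Fin n ↦ P) i).map_eq
    conv_rhs => rw [← this, Measure.map_map (hX _) (measurable_pi_apply i)]
    rfl
  have hmeas : ∀ i : Fin n, AEMeasurable (fun ω : Fin n → Ω ↦ X (t ^ (1 / α)) (ω i))
      (Measure.pi fun _ : Fin n ↦ P) := fun i ↦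
    ((hX _).comp (measurable_pi_apply i)).aemeasurable
  rw [h2, hind.charFun_map_fun_sum_eq_prod hmeas]
  simp only [hmap, Finset.prod_const, Finset.card_univ, Fintype.card_fin, Pi.pow_apply]

/-- A process whose law at time `n * t` is always the `n`-th convolution power of its law at time
`t` starts at `0`. -/
lemma ae_zero_of_charFun_eq_pow (hY : ∀ t, Measurable (Y t))
    (hpow : ∀ n : ℕ, 0 < n → ∀ t ξ,
      charFun (P.map (Y (n * t))) ξ = charFun (P.map (Y t)) ξ ^ n) :
    ∀ᵐ ω ∂P, Y 0 ω = 0 := by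
  have := Measure.isProbabilityMeasure_map (μ := P) (hY 0).aemeasurable
  have hd := eq_dirac_zero_of_charFun_eq_sq (μ := P.map (Y 0))
    fun ξ ↦ by simpa using hpow 2 two_pos 0 ξ
  have : ∀ᵐ z ∂(P.map (Y 0)), z = 0 := by simp [hd, ae_dirac_eq]
  exact ae_of_ae_map (hY 0).aemeasurable this

/-- The characteristic function never vanishes: it is the `n`-th power of that of `Y (t / n)`, which
is close to `1` for large `n`. -/
lemma charFun_ne_zero_of_eq_pow (hY : ∀ t, Measurable (Y t))
    (hcont : IsStochasticallyContinuous Y P)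
    (hpow : ∀ n : ℕ, 0 < n → ∀ t ξ,
      charFun (P.map (Y (n * t))) ξ = charFun (P.map (Y t)) ξ ^ n) (t : ℝ≥0) (ξ : E) :
    charFun (P.map (Y t)) ξ ≠ 0 := by
  have h0 := charFun_map_zero (ae_zero_of_charFun_eq_pow hY hpow) ξ
  have hlim : Tendsto (fun n : ℕ ↦ charFun (P.map (Y (t / n))) ξ) atTop (𝓝 1) := by
    rw [← h0]
    exact ((hcont.continuous_charFun hY ξ).tendsto 0).comp
      (tendsto_const_div_atTop_nhds_zero_nat t)
  obtain ⟨n, hn, hn0⟩ := ((hlim.eventually_ne one_ne_zero).and (eventually_gt_atTop 0)).exists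
  have := hpow n hn0 (t / n) ξ
  rw [mul_div_cancel₀ _ (by positivity)] at this
  rw [this]
  exact pow_ne_zero n hn

/-- The marginal laws form a convolution semigroup: the relation is clear for dyadic times and
extends by continuity. -/
lemma charFun_add_of_eq_pow (hY : ∀ t, Measurable (Y t))
    (hcont : IsStochasticallyContinuous Y P)
    (hpow : ∀ n : ℕ, 0 < n → ∀ t ξ,
      charFun (P.map (Y (n * t))) ξ = charFun (P.map (Y t)) ξ ^ n) (s t : ℝ≥0) (ξ : E) :
    charFun (P.map (Y (s + t))) ξ = charFun (P.map (Y s)) ξ * charFun (P.map (Y t)) ξ := by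
  have hc := hcont.continuous_charFun hY ξ
  have hpow' : ∀ (n : ℕ) (t : ℝ≥0),
      charFun (P.map (Y (n * t))) ξ = charFun (P.map (Y t)) ξ ^ n := fun n t ↦ by
    rcases n.eq_zero_or_pos with rfl | hn
    · simpa using charFun_map_zero (ae_zero_of_charFun_eq_pow hY hpow) ξ
    · exact hpow n hn t ξ
  have key : (fun q : ℝ≥0 × ℝ≥0 ↦ charFun (P.map (Y (q.1 + q.2))) ξ) =
      fun q ↦ charFun (P.map (Y q.1)) ξ * charFun (P.map (Y q.2)) ξ := by
    refine Continuous.ext_on (dense_dyadics.prod dense_dyadics) (hc.comp continuous_add)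
      ((hc.comp continuous_fst).mul (hc.comp continuous_snd)) ?_
    rintro ⟨s, t⟩ ⟨hs, ht⟩
    obtain ⟨n, i, rfl⟩ := Set.mem_iUnion.1 hs
    obtain ⟨m, j, rfl⟩ := Set.mem_iUnion.1 ht
    -- both times are multiples of `u`
    let u : ℝ≥0 := 1 / 2 ^ (n + m)
    have h1 : (i : ℝ≥0) / 2 ^ n = ((i * 2 ^ m : ℕ) : ℝ≥0) * u := by
      simp only [u]
      push_cast
      rw [pow_add]
      field_simp
    have h2 : (j : ℝ≥0) / 2 ^ m = ((j * 2 ^ n : ℕ) : ℝ≥0) * u := by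
      simp only [u]
      push_cast
      rw [pow_add]
      field_simp
    simp only [h1, h2, ← add_mul, ← Nat.cast_add, hpow', pow_add]
  exact congrFun key (s, t)

lemma identDistrib_increments_of_eq_pow (hY : ∀ t, Measurable (Y t))
    (hcont : IsStochasticallyContinuous Y P) (hind : HasIndepIncrements Y P)
    (hpow : ∀ n : ℕ, 0 < n → ∀ t ξ,
      charFun (P.map (Y (n * t))) ξ = charFun (P.map (Y t)) ξ ^ n) (s t : ℝ≥0) :
    IdentDistrib (fun ω ↦ Y (s + t) ω - Y s ω) (fun ω ↦ Y t ω - Y 0 ω) P P := by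
  have hzero := ae_zero_of_charFun_eq_pow hY hpow
  refine ⟨((hY _).sub (hY _)).aemeasurable, ((hY _).sub (hY _)).aemeasurable, ?_⟩
  have hY0 : P.map (fun ω ↦ Y t ω - Y 0 ω) = P.map (Y t) :=
    Measure.map_congr (by filter_upwards [hzero] with ω hω; simp [hω])
  rw [hY0]
  have := Measure.isProbabilityMeasure_map (μ := P) ((hY (s + t)).sub (hY s)).aemeasurable
  have := Measure.isProbabilityMeasure_map (μ := P) (hY t).aemeasurable
  refine Measure.ext_of_charFun (funext fun ξ ↦ ?_)
  have h1 := congrFun ((hind.indepFun_eval_sub (zero_le (a := s)) (le_self_add (b := t))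
    hzero).charFun_map_add_eq_mul (hY s).aemeasurable ((hY (s + t)).sub (hY s)).aemeasurable) ξ
  rw [add_sub_cancel, Pi.mul_apply, charFun_add_of_eq_pow hY hcont hpow] at h1
  exact (mul_left_cancel₀ (charFun_ne_zero_of_eq_pow hY hcont hpow s ξ) h1).symm

end Stationary

/-! ### The Lévy process -/

section Levy

variable {Ω E : Type*} [mΩ : MeasurableSpace Ω] [NormedAddCommGroup E] {P : Measure Ω}
  {X Y : ℝ≥0 → Ω → E}

lemma IsStochasticallyContinuous.comp (hX : IsStochasticallyContinuous X P) {θ : ℝ≥0 → ℝ≥0}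
    (hθ : Continuous θ) : IsStochasticallyContinuous (fun t ↦ X (θ t)) P :=
  fun t ↦ (hX (θ t)).comp (hθ.tendsto t)

lemma IsStochasticallyContinuous.congr (hX : IsStochasticallyContinuous X P)
    (h : ∀ t, X t =ᵐ[P] Y t) : IsStochasticallyContinuous Y P :=
  fun t ↦ TendstoInMeasure.congr h (h t) (hX t)

variable [MeasurableSpace E]

lemma hasIndepIncrements_congr (hX : HasIndepIncrements X P) (h : ∀ t, X t =ᵐ[P] Y t) :
    HasIndepIncrements Y P :=
  fun n t ht ↦ (hX n t ht).congr fun _ ↦ (h _).sub (h _)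

lemma hasIndepIncrements_comp (hX : HasIndepIncrements X P) {θ : ℝ≥0 → ℝ≥0} (hθ : Monotone θ) :
    HasIndepIncrements (fun t ↦ X (θ t)) P :=
  fun n t ht ↦ hX n (θ ∘ t) (hθ.comp ht)

lemma isLevyProcess_of_modification [BorelSpace E] [SecondCountableTopology E]
    (hind : HasIndepIncrements Y P)
    (hstat : ∀ s t, IdentDistrib (fun ω ↦ Y (s + t) ω - Y s ω) (fun ω ↦ Y t ω - Y 0 ω) P P)
    (hzero : ∀ᵐ ω ∂P, Y 0 ω = 0) (hcont : IsStochasticallyContinuous Y P)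
    (hX : ∀ t, Measurable (X t)) (hcadlag : ∀ᵐ ω ∂P, IsCadlagPath fun t ↦ X t ω)
    (h : ∀ t, X t =ᵐ[P] Y t) : IsLevyProcess X P where
  measurable := hX
  indepIncrements := hasIndepIncrements_congr hind fun t ↦ (h t).symm
  stationaryIncrements s t := by
    have h1 : ∀ s t, IdentDistrib (fun ω ↦ X t ω - X s ω) (fun ω ↦ Y t ω - Y s ω) P P :=
      fun s t ↦ IdentDistrib.of_ae_eq ((hX t).sub (hX s)).aemeasurable ((h t).sub (h s))
    exact ((h1 _ _).trans (hstat s t)).trans (h1 _ _).symm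
  start_zero := by
    filter_upwards [h 0, hzero] with ω h1 h2 using h1.trans h2
  stochasticallyContinuous := hcont.congr fun t ↦ (h t).symm
  cadlag := hcadlag

end Levy

end AlphaIDT

theorem mainTheorem3 {Ω E : Type*} [MeasurableSpace Ω]
    [NormedAddCommGroup E] [InnerProductSpace ℝ E] [FiniteDimensional ℝ E]
    [MeasurableSpace E] [BorelSpace E]
    (P : Measure Ω) [IsProbabilityMeasure P]
    (α : ℝ) (hα : 0 < α)
    (X : ℝ≥0 → Ω → E) (hX : ∀ t, Measurable (X t))
    (hIDT : AlphaIDT.IsAlphaIDT α X P)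
    (hcont : AlphaIDT.IsStochasticallyContinuous X P)
    (hindep : HasIndepIncrements X P) :
    ∃ L : ℝ≥0 → Ω → E, AlphaIDT.IsLevyProcess L P ∧
      ∀ t : ℝ≥0, ∀ᵐ ω ∂P, X t ω = L (t ^ α) ω := by
  have hα' : 0 < 1 / α := one_div_pos.2 hα
  have := FiniteDimensional.complete ℝ E
  have hY : ∀ t, Measurable (X (t ^ (1 / α))) := fun t ↦ hX _
  have hYind : HasIndepIncrements (fun t : ℝ≥0 ↦ X (t ^ (1 / α))) P :=
    AlphaIDT.hasIndepIncrements_comp hindep (NNReal.monotone_rpow_of_nonneg hα'.le)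
  have hYcont : AlphaIDT.IsStochasticallyContinuous (fun t : ℝ≥0 ↦ X (t ^ (1 / α))) P :=
    hcont.comp (NNReal.continuous_rpow_const hα'.le)
  have hpow := fun (n : ℕ) (hn : 0 < n) (t : ℝ≥0) (ξ : E) ↦ hIDT.charFun_eq_pow hX hn t ξ
  obtain ⟨L, hL, hcadlag, hLY⟩ := AlphaIDT.exists_cadlag_modification hY hYind hYcont
  refine ⟨L, AlphaIDT.isLevyProcess_of_modification hYind
    (AlphaIDT.identDistrib_increments_of_eq_pow hY hYcont hYind hpow)
    (AlphaIDT.ae_zero_of_charFun_eq_pow hY hpow) hYcont hL hcadlag hLY, fun t ↦ ?_⟩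
  filter_upwards [hLY (t ^ α)] with ω hω
  rw [hω, ← NNReal.rpow_mul, mul_one_div_cancel hα.ne', NNReal.rpow_one]
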